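/- For $n\ge 1$, let the Kneser cube $Kn_n$ be the graph whose vertices are all subsets of $[n]=\{1,\dots,n\}$, two distinct subsets being adjacent if and only if they are disjoint. For a finite graph $G$, let $\mathrm{vex}(n,G)$ be the largest size of a family $\mathcal F\subseteq 2^{[n]}$ such that the subgraph of $Kn_n$ induced by $\mathcal F$ contains no (not necessarily induced) subgraph isomorphic to $G$. Theorem. Let $G$ be a fixed finite bipartite graph that is not a matching, that is, $G$ has at least one vertex of degree at least $2$. Then, as $n\to\infty$, $$2^{n-1}+\left(\tfrac12-o(1)\right)\binom{n}{\lfloor n/2\rfloor}\le \mathrm{vex}(n,G)\le 2^{n-1}+(1+o(1))\binom{n}{\lfloor n/2\rfloor},$$ where the $o(1)$ terms may depend on $G$. -/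

import Mathlib

open Filter Topology

namespace KneserCube

/-- The Kneser cube: its vertices are all subsets of an `n`-element set, and two (distinct)
subsets are adjacent if and only if they are disjoint. (Only the empty set is disjoint from
itself; as usual there is no loop there.) -/
def kneserCube (n : ℕ) : SimpleGraph (Finset (Fin n)) where
  Adj A B := A ≠ B ∧ Disjoint A B
  symm := ⟨fun _ _ h => ⟨h.1.symm, h.2.symm⟩⟩
  loopless := ⟨fun _ h => h.1 rfl⟩

open Classical in
/-- `vex n G`: the largest number of vertices of the Kneser cube whose induced subgraph is
`G`-free, i.e. contains no (not necessarily induced) subgraph isomorphic to `G`. -/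
noncomputable def vex {V : Type*} (n : ℕ) (G : SimpleGraph V) : ℕ :=
  (Finset.univ.filter fun F : Finset (Finset (Fin n)) =>
    G.Free ((kneserCube n).induce (F : Set (Finset (Fin n))))).sup Finset.card

/-- `G` is a matching (possibly together with isolated vertices): every vertex has at most one
neighbour. -/
def IsMatchingGraph {V : Type*} (G : SimpleGraph V) : Prop :=
  ∀ v u w : V, G.Adj v u → G.Adj v w → u = w

end KneserCube

namespace KneserCube

open Finset Numbering
open scoped FinsetFamily Nat

/-! ### Chains as numberings, and a Sperner-type bound -/

section Numberings

variable {X : Type*} [Fintype X] [DecidableEq X]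

/-! Upper bound: for a `G`-free `F`, let `D` be the sets lying in `F` together with their
complements; then `2 * #F ≤ 2 ^ n + #D`. If some `A` had many proper subsets and many proper
supersets in `D`, those subsets and the complements of those supersets would span a large complete
bipartite graph inside `F`, containing `G` (`isContained_induce_of_many`). So up to complementation
each member of `D` has few supersets in `D`, and counting maximal chains, encoded as numberings,
bounds such a family by `(1 + o(1))` middle binomials (`card_mul_le_of_few_supersets`). Lower bound:
in a family whose disjoint pairs have sizes summing to at least `n`, adjacency means being
complementary, so only matchings occur (`card_le_vex`). The upper half of the cube, enlarged by a
star in odd dimension, is such a family. -/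

lemma factorial_mul_factorial_succ_le (l i : ℕ) : (l + 1)! * (i + 1)! ≤ (l + i + 1)! := by
  induction l with
  | zero => simp
  | succ l ih =>
    rw [Nat.factorial_succ (l + 1), mul_assoc, show l + 1 + i + 1 = l + i + 1 + 1 by ring,
      Nat.factorial_succ (l + i + 1)]
    gcongr
    omega

lemma factorial_mul_factorial_sub_le {m k : ℕ} (hk : 1 ≤ k) (hkm : k < m) :
    k ! * (m - k)! ≤ (m - 1)! := by
  convert factorial_mul_factorial_succ_le (k - 1) (m - k - 1) using 3 <;> omega

/-- Among the numberings with prefix `s`, few also have a given larger proper prefix `t`. -/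
lemma card_prefixed_inter_le {s t : Finset X} (hst : s ⊂ t) (ht : t ≠ univ) :
    (Fintype.card X - #s) * #(prefixed s ∩ prefixed t) ≤ #(prefixed s) := by
  have hst' := card_lt_card hst
  have htX : #t < Fintype.card X := by
    rw [← card_univ]; exact card_lt_card (ssubset_univ_iff.2 ht)
  let u : Finset ↑(sᶜ) := t.subtype (· ∈ sᶜ)
  have hu : #u = #t - #s := by
    rw [← card_sdiff_of_subset hst.1, card_subtype]
    congr 1; ext x; simp [and_comm]
  -- A numbering with prefixes `s` and `t` splits into a numbering of `s` and one of `sᶜ` with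
  -- prefix `t \ s`. The `else` value below is never used.
  have key : #(prefixed s ∩ prefixed t) ≤
      #((univ : Finset (Numbering s)) ×ˢ (prefixed u : Finset (Numbering ↑(sᶜ)))) := by
    refine card_le_card_of_injOn
      (fun f => if h : f ∈ prefixed s then prefixedEquiv s ⟨f, h⟩ else
        (Fintype.equivFin _, Fintype.equivFin _)) ?_ ?_
    · intro f hf
      simp only [coe_inter, Set.mem_inter_iff, mem_coe] at hf
      obtain ⟨hs, ht⟩ := hf
      simp only [hs, dif_pos, coe_product, Set.mem_prod, mem_coe, mem_univ, true_and]
      rw [mem_prefixed] at ht ⊢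
      intro x
      have h1 : ((prefixedEquiv s ⟨f, hs⟩).2 x : ℕ) = f x - #s := rfl
      have h2 := (mem_prefixed.1 hs x).not.1 (Finset.mem_compl.1 x.2)
      rw [h1, hu, mem_subtype, ht x]
      omega
    · intro f hf g hg hfg
      simp only [coe_inter, Set.mem_inter_iff, mem_coe] at hf hg
      simp only [hf.1, hg.1, dif_pos] at hfg
      simpa using (prefixedEquiv s).injective hfg
  rw [card_product, card_prefixed, card_univ, Fintype.card_numbering, hu, Fintype.card_coe,
    Fintype.card_coe, card_compl] at key
  have h4 := factorial_mul_factorial_sub_le (m := Fintype.card X - #s) (k := #t - #s)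
    (by omega) (by omega)
  rw [card_prefixed, ← Nat.mul_factorial_pred (n := Fintype.card X - #s) (by omega)]
  calc _ ≤ (Fintype.card X - #s) * ((#s)! * (Fintype.card X - #s - 1)!) := by
        gcongr; exact key.trans (by gcongr)
    _ = _ := by ring

/-- A set family in which every member has at most `t` proper supersets in the family and
misses at least `K` points has a bounded number of members: the fork-free version of Sperner's
theorem. -/
lemma card_mul_le_of_few_supersets {U : Finset (Finset X)} {t K : ℕ} (hK : 1 ≤ K)
    (hsup : ∀ A ∈ U, #{B ∈ U | A ⊂ B} ≤ t) (hcard : ∀ A ∈ U, #A + K ≤ Fintype.card X) :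
    #U * (K - t) ≤ K * (Fintype.card X).choose (Fintype.card X / 2) := by
  set n := Fintype.card X with hn
  set S := ∑ A ∈ U, #(prefixed A) with hS
  -- Each of the at most `t` supersets captures at most a `1 / K` share of the numberings through
  -- `A`, since `A` misses at least `K` points.
  have hpair : ∀ A ∈ U, K * #{f ∈ prefixed A | ∃ B ∈ U, A ⊂ B ∧ f ∈ prefixed B} ≤
      t * #(prefixed A) := by
    intro A hA
    have h1 : ({f ∈ prefixed A | ∃ B ∈ U, A ⊂ B ∧ f ∈ prefixed B} : Finset (Numbering X)) ⊆
        ({B ∈ U | A ⊂ B} : Finset _).biUnion fun B => prefixed A ∩ prefixed B := by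
      intro f hf
      simp only [mem_filter] at hf
      obtain ⟨hf, B, hB, hAB, hfB⟩ := hf
      simp only [mem_biUnion, mem_filter, mem_inter]
      exact ⟨B, ⟨hB, hAB⟩, hf, hfB⟩
    calc _ ≤ K * ∑ B ∈ U with A ⊂ B, #(prefixed A ∩ prefixed B) := by
          gcongr; exact (card_le_card h1).trans card_biUnion_le
      _ = ∑ B ∈ U with A ⊂ B, K * #(prefixed A ∩ prefixed B) := mul_sum ..
      _ ≤ ∑ B ∈ U with A ⊂ B, #(prefixed A) := by
          refine sum_le_sum fun B hB => ?_
          rw [mem_filter] at hB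
          have hA' := hcard A hA
          refine le_trans ?_ (card_prefixed_inter_le hB.2 ?_)
          · gcongr; omega
          · rintro rfl
            have := hcard _ hB.1
            rw [card_univ] at this
            omega
      _ = #{B ∈ U | A ⊂ B} * #(prefixed A) := by simp
      _ ≤ _ := by gcongr; exact hsup A hA
  -- Prefixes of one numbering form a chain, so each numbering is counted only at its largest prefix
  -- in `U`.
  have htop : ∑ A ∈ U, #{f ∈ prefixed A | ¬ ∃ B ∈ U, A ⊂ B ∧ f ∈ prefixed B} ≤ n ! := by
    rw [← card_biUnion, hn, ← Fintype.card_numbering]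
    · exact card_le_univ _
    · intro A hA B hB hAB
      rw [Function.onFun, Finset.disjoint_left]
      intro f hfA hfB
      rw [mem_filter] at hfA hfB
      rcases le_total (#A) (#B) with h | h
      · exact hfA.2 ⟨B, hB, ((mem_prefixed.1 hfA.1).subset_of_card_le_card
          (mem_prefixed.1 hfB.1) h).ssubset_of_ne hAB, hfB.1⟩
      · exact hfB.2 ⟨A, hA, ((mem_prefixed.1 hfB.1).subset_of_card_le_card
          (mem_prefixed.1 hfA.1) h).ssubset_of_ne hAB.symm, hfA.1⟩
  have hKS : K * S ≤ t * S + K * n ! := by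
    calc K * S = ∑ A ∈ U, K * #{f ∈ prefixed A | ∃ B ∈ U, A ⊂ B ∧ f ∈ prefixed B} +
          K * ∑ A ∈ U, #{f ∈ prefixed A | ¬ ∃ B ∈ U, A ⊂ B ∧ f ∈ prefixed B} := by
          rw [← mul_sum, ← mul_add, ← sum_add_distrib, hS]
          congr 1
          exact sum_congr rfl fun A _ => (card_filter_add_card_filter_not _).symm
      _ ≤ ∑ A ∈ U, t * #(prefixed A) + K * n ! := by
          exact add_le_add (sum_le_sum hpair) (Nat.mul_le_mul_left _ htop)
      _ = _ := by rw [← mul_sum]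
  have hKS' : S * (K - t) ≤ K * n ! := by
    rw [Nat.mul_sub, mul_comm S K, mul_comm S t]; omega
  have hU : #U * n ! ≤ S * n.choose (n / 2) := by
    rw [hS, sum_mul, ← smul_eq_mul, ← sum_const]
    refine sum_le_sum fun A _ => ?_
    rw [card_prefixed, ← Nat.choose_mul_factorial_mul_factorial (card_le_univ A), mul_assoc,
      mul_comm]
    gcongr
    exact Nat.choose_le_middle _ _
  refine Nat.le_of_mul_le_mul_right ?_ (Nat.factorial_pos n)
  calc #U * (K - t) * n ! = #U * n ! * (K - t) := by ring
    _ ≤ S * n.choose (n / 2) * (K - t) := by gcongr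
    _ = S * (K - t) * n.choose (n / 2) := by ring
    _ ≤ K * n ! * n.choose (n / 2) := by gcongr
    _ = _ := by ring

/-- The chain count needs `K` missing points; the sets excluded by this are only polynomially many.
-/
lemma card_filter_card_lt_le (K : ℕ) :
    #{A : Finset X | Fintype.card X < #A + K} ≤ K * (Fintype.card X + 1) ^ K := by
  have h : #{A : Finset X | Fintype.card X < #A + K} ≤ #{A : Finset X | #A < K} := by
    refine card_le_card_of_injOn compl ?_ compl_injective.injOn
    intro A hA
    have := card_le_univ A
    simp only [coe_filter, mem_univ, true_and, Set.mem_ofPred_eq, card_compl] at hA ⊢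
    omega
  have h2 : ({A : Finset X | #A < K} : Finset _) ⊆
      (range K).biUnion fun i => powersetCard i univ := by
    intro A; simp
  calc _ ≤ _ := h.trans ((card_le_card h2).trans card_biUnion_le)
    _ ≤ ∑ i ∈ range K, (Fintype.card X + 1) ^ K := by
        refine sum_le_sum fun i hi => ?_
        rw [card_powersetCard, card_univ]
        refine (Nat.choose_le_pow _ _).trans ?_
        calc _ ≤ (Fintype.card X + 1) ^ i := by gcongr; omega
          _ ≤ _ := by gcongr; omega; exact (mem_range.1 hi).le
    _ = _ := by simp

/-- Inclusion–exclusion for a family and the family of its complements. -/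
lemma two_mul_card_eq (F : Finset (Finset X)) : 2 * #F = #(F ∪ Fᶜˢ) + #(F ∩ Fᶜˢ) := by
  rw [card_union_add_card_inter, card_compls]; ring

end Numberings

/-! ### Upper bound -/

section UpperBound

variable {V : Type*} {n : ℕ}

/-- A bipartite graph embeds into the Kneser cube via many subsets and many supersets of a
single set. -/
lemma isContained_induce_of_many [Finite V] {G : SimpleGraph V} (hbip : G.IsBipartite)
    {F : Finset (Finset (Fin n))} {A : Finset (Fin n)}
    (hsub : Nat.card V < #{B ∈ F ∩ Fᶜˢ | B ⊂ A}) (hsup : Nat.card V < #{B ∈ F ∩ Fᶜˢ | A ⊂ B}) :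
    G.IsContained ((kneserCube n).induce (F : Set (Finset (Fin n)))) := by
  classical
  have := Fintype.ofFinite V
  obtain ⟨c⟩ := hbip
  rw [Nat.card_eq_fintype_card] at hsub hsup
  obtain ⟨f⟩ : Nonempty (V ↪ ({B ∈ F ∩ Fᶜˢ | B ⊂ A} : Finset (Finset (Fin n)))) :=
    Function.Embedding.nonempty_of_card_le (by rw [Fintype.card_coe]; exact hsub.le)
  -- Erasing `univ` keeps the two sides distinct: a common set would be disjoint from itself, hence
  -- empty. The strict inequality in `hsup` pays for it.
  obtain ⟨g⟩ : Nonempty (V ↪ (({B ∈ F ∩ Fᶜˢ | A ⊂ B} : Finset (Finset (Fin n))).erase univ)) :=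
    Function.Embedding.nonempty_of_card_le (by
      rw [Fintype.card_coe]
      exact (Nat.le_sub_one_of_lt hsup).trans pred_card_le_card_erase)
  have hf : ∀ v, ((f v : Finset (Fin n)) ∈ F) ∧ (f v : Finset (Fin n)) ⊂ A := fun v => by
    have := (f v).2
    simp only [mem_filter, mem_inter] at this
    exact ⟨this.1.1, this.2⟩
  have hg : ∀ v, ((g v : Finset (Fin n))ᶜ ∈ F) ∧ A ⊂ (g v : Finset (Fin n)) ∧
      (g v : Finset (Fin n)) ≠ univ := fun v => by
    have := (g v).2
    simp only [mem_erase, mem_filter, mem_inter, mem_compls] at this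
    exact ⟨this.2.1.2, this.2.2, this.1⟩
  have hdisj : ∀ v w, Disjoint (f v : Finset (Fin n)) (g w : Finset (Fin n))ᶜ := fun v w =>
    disjoint_compl_right_iff.2 ((hf v).2.subset.trans (hg w).2.1.subset)
  have hne : ∀ v w, (f v : Finset (Fin n)) ≠ (g w : Finset (Fin n))ᶜ := fun v w h => by
    have h1 := hdisj v w
    rw [h, disjoint_self, bot_eq_empty, compl_eq_empty_iff] at h1
    exact (hg w).2.2 h1
  let ι : V → (F : Set (Finset (Fin n))) := fun v =>
    if c v = 0 then ⟨f v, (hf v).1⟩ else ⟨(g v : Finset (Fin n))ᶜ, (hg v).1⟩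
  have hadj : ∀ v w, c v = 0 → c w ≠ 0 →
      ((kneserCube n).induce (F : Set (Finset (Fin n)))).Adj (ι v) (ι w) := by
    intro v w hv hw
    simp only [ι, hv, hw, if_true, if_false, SimpleGraph.comap_adj]
    exact ⟨hne v w, hdisj v w⟩
  refine ⟨⟨⟨ι, ?_⟩, ?_⟩⟩
  · intro v w hvw
    have := c.valid hvw
    by_cases hv : c v = 0
    · exact hadj v w hv (fun hw => this (hv.trans hw.symm))
    · have hw : c w = 0 := by omega
      exact (hadj w v hw hv).symm
  · intro v w hvw
    change ι v = ι w at hvw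
    by_cases hv : c v = 0 <;> by_cases hw : c w = 0 <;>
      simp only [ι, hv, hw, if_true, if_false, Subtype.mk.injEq, compl_inj_iff] at hvw
    · exact f.injective (Subtype.ext hvw)
    · exact absurd hvw (hne v w)
    · exact absurd hvw.symm (hne w v)
    · exact g.injective (Subtype.ext hvw)

lemma card_le_of_free [Finite V] {G : SimpleGraph V} (hbip : G.IsBipartite) (hn : 1 ≤ n)
    {F : Finset (Finset (Fin n))}
    (hF : G.Free ((kneserCube n).induce (F : Set (Finset (Fin n))))) {K : ℕ} (hK : 1 ≤ K) :
    #F * (K - Nat.card V) ≤ (2 ^ (n - 1) + K * (n + 1) ^ K) * (K - Nat.card V) +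
      K * n.choose (n / 2) := by
  set t := Nat.card V
  set D := F ∩ Fᶜˢ with hD
  set U : Finset (Finset (Fin n)) := {A ∈ D | #{B ∈ D | A ⊂ B} ≤ t} with hU
  have hDc : ∀ A, Aᶜ ∈ D ↔ A ∈ D := fun A => by simp [hD, and_comm]
  -- If neither `A` nor `Aᶜ` is in `U`, complementing the supersets of `Aᶜ` gives `A` many subsets
  -- as well.
  have hDU : D ⊆ U ∪ Uᶜˢ := by
    intro A hA
    by_contra hA'
    simp only [hU, mem_union, mem_filter, hA, true_and, mem_compls, (hDc A).2 hA, not_or,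
      not_le] at hA'
    refine hF (isContained_induce_of_many hbip (A := A) (hA'.2.trans_le ?_) hA'.1)
    refine card_le_card_of_injOn compl ?_ compl_injective.injOn
    intro B hB
    simp only [coe_filter, Set.mem_ofPred_eq] at hB ⊢
    exact ⟨(hDc B).2 hB.1, compl_lt_compl_iff_lt.1 (by rw [compl_compl]; exact hB.2)⟩
  have hDcard : #D ≤ 2 * #U := by
    refine (card_le_card hDU).trans ((card_union_le _ _).trans ?_)
    rw [card_compls]; omega
  have hFcard : #F ≤ 2 ^ (n - 1) + #U := by
    have h1 := two_mul_card_eq F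
    have h2 : #(F ∪ Fᶜˢ) ≤ 2 ^ n := (card_le_univ _).trans (by simp)
    have h3 : 2 ^ n = 2 * 2 ^ (n - 1) := by rw [← pow_succ']; congr 1; omega
    rw [hD] at hDcard
    omega
  have hsplit : #U ≤ #{A ∈ U | #A + K ≤ n} + K * (n + 1) ^ K := by
    rw [← card_filter_add_card_filter_not (s := U) (fun A => #A + K ≤ n)]
    gcongr
    have := card_filter_card_lt_le (X := Fin n) K
    rw [Fintype.card_fin] at this
    refine (card_le_card ?_).trans this
    intro A
    simp only [mem_filter, mem_univ, true_and]
    omega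
  have hmain := card_mul_le_of_few_supersets (U := {A ∈ U | #A + K ≤ n}) (t := t) hK
    (fun A hA => by
      simp only [hU, mem_filter] at hA
      refine (card_le_card ?_).trans hA.1.2
      intro B hB
      simp only [hU, mem_filter] at hB ⊢
      exact ⟨hB.1.1.1, hB.2⟩)
    (fun A hA => by rw [Fintype.card_fin]; exact (mem_filter.1 hA).2)
  rw [Fintype.card_fin] at hmain
  calc #F * (K - t) ≤ (2 ^ (n - 1) + (#{A ∈ U | #A + K ≤ n} + K * (n + 1) ^ K)) * (K - t) := by
        gcongr; omega
    _ = (2 ^ (n - 1) + K * (n + 1) ^ K) * (K - t) + #{A ∈ U | #A + K ≤ n} * (K - t) := by ring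
    _ ≤ _ := by gcongr

lemma vex_mul_le [Finite V] {G : SimpleGraph V} (hbip : G.IsBipartite) (hn : 1 ≤ n) {K : ℕ}
    (hK : 1 ≤ K) :
    vex n G * (K - Nat.card V) ≤ (2 ^ (n - 1) + K * (n + 1) ^ K) * (K - Nat.card V) +
      K * n.choose (n / 2) := by
  classical
  rw [vex]
  rcases Finset.eq_empty_or_nonempty (univ.filter fun F : Finset (Finset (Fin n)) =>
    G.Free ((kneserCube n).induce (F : Set (Finset (Fin n))))) with h | h
  · rw [h]; simp
  · obtain ⟨F, hF, hFs⟩ := exists_mem_eq_sup _ h Finset.card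
    rw [hFs]
    exact card_le_of_free hbip hn (mem_filter.1 hF).2 hK

lemma two_pow_le_mul_choose_middle (n : ℕ) : 2 ^ n ≤ (n + 1) * n.choose (n / 2) := by
  rw [← Nat.sum_range_choose]
  refine (sum_le_sum fun i _ => Nat.choose_le_middle i n).trans ?_
  simp

lemma tendsto_pow_div_choose_middle (K : ℕ) :
    Tendsto (fun n : ℕ => (K * (n + 1) ^ K : ℝ) / n.choose (n / 2)) atTop (𝓝 0) := by
  have h1 : Tendsto (fun n : ℕ => 2 * K * (((n + 1 : ℕ) : ℝ) ^ (K + 1) / 2 ^ (n + 1)))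
      atTop (𝓝 0) := by
    simpa using ((tendsto_pow_const_div_const_pow_of_one_lt (K + 1) one_lt_two).comp
      (tendsto_add_atTop_nat 1)).const_mul (2 * K : ℝ)
  refine squeeze_zero (fun n => by positivity) (fun n => ?_) h1
  have hC : (0 : ℝ) < n.choose (n / 2) := by
    exact_mod_cast Nat.choose_pos (Nat.div_le_self n 2)
  have h2 : (2 : ℝ) ^ n ≤ (n + 1) * n.choose (n / 2) := by
    exact_mod_cast two_pow_le_mul_choose_middle n
  have : (2 * K * (((n + 1 : ℕ) : ℝ) ^ (K + 1) / 2 ^ (n + 1))) =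
      K * (n + 1) ^ K * (n + 1) / 2 ^ n := by
    push_cast; field_simp; ring
  rw [this, div_le_div_iff₀ hC (by positivity), mul_assoc _ ((n : ℝ) + 1)]
  gcongr

lemma eventually_vex_le [Finite V] {G : SimpleGraph V} (hbip : G.IsBipartite) {ε : ℝ}
    (hε : 0 < ε) :
    ∀ᶠ n : ℕ in atTop, (vex n G : ℝ) ≤ 2 ^ (n - 1) + (1 + ε) * n.choose (n / 2) := by
  -- With `K = Nat.card V + (r + 1)`, the factor `K / (K - Nat.card V)` is at most `1 + ε / 2`; the
  -- other `ε / 2` absorbs the polynomial term.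
  obtain ⟨r, hr⟩ := exists_nat_gt (2 * (Nat.card V : ℝ) / ε)
  have hsmall := (tendsto_pow_div_choose_middle (Nat.card V + (r + 1))).eventually_lt_const
    (half_pos hε)
  filter_upwards [hsmall, eventually_ge_atTop 1] with n h1 hn
  have hC : (0 : ℝ) < n.choose (n / 2) := by
    exact_mod_cast Nat.choose_pos (Nat.div_le_self n 2)
  have h2 := vex_mul_le hbip hn (K := Nat.card V + (r + 1)) (by omega)
  rw [Nat.add_sub_cancel_left] at h2
  rw [div_lt_iff₀ hC] at h1
  have h3 : (vex n G : ℝ) * (r + 1) ≤ (2 ^ (n - 1) + ((Nat.card V + (r + 1) : ℕ) : ℝ) *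
      (n + 1) ^ (Nat.card V + (r + 1))) * (r + 1) +
      (Nat.card V + (r + 1)) * n.choose (n / 2) := by exact_mod_cast h2
  rw [div_lt_iff₀ hε] at hr
  have hr0 : (0 : ℝ) < r + 1 := by positivity
  refine le_of_mul_le_mul_right (h3.trans ?_) hr0
  have h4 : (Nat.card V : ℝ) * n.choose (n / 2) ≤ ε / 2 * (r + 1) * n.choose (n / 2) := by
    gcongr; nlinarith
  nlinarith [mul_le_mul_of_nonneg_right h1.le hr0.le]

end UpperBound

/-! ### Lower bound -/

section LowerBound

variable {V : Type*} {n : ℕ}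

/-- Disjoint sets with sizes summing to at least `n` are complements, so every member of `F` has at
most one neighbour. -/
lemma card_le_vex {G : SimpleGraph V} (hG : ¬ IsMatchingGraph G) {F : Finset (Finset (Fin n))}
    (hF : ∀ A ∈ F, ∀ B ∈ F, A ≠ B → Disjoint A B → n ≤ #A + #B) : #F ≤ vex n G := by
  classical
  refine le_sup (f := Finset.card) (mem_filter.2 ⟨mem_univ _, ?_⟩)
  rintro ⟨ι⟩
  apply hG
  have key : ∀ v u, G.Adj v u → ((ι u : Finset (Fin n))) = (ι v : Finset (Fin n))ᶜ := by
    intro v u h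
    obtain ⟨hne, hd⟩ := ι.toHom.map_adj h
    have hle := hF _ (ι v).2 _ (ι u).2 hne hd
    refine eq_of_subset_of_card_le (subset_compl_iff_disjoint_left.2 hd) ?_
    rw [card_compl, Fintype.card_fin]
    omega
  intro v u w hu hw
  exact ι.injective (Subtype.ext ((key v u hu).trans (key v w hw).symm))

lemma le_vex_of_even {G : SimpleGraph V} (hG : ¬ IsMatchingGraph G) (m : ℕ) :
    2 ^ (2 * m) + (2 * m).choose m ≤ 2 * vex (2 * m) G := by
  have h : #({A | m ≤ #A} : Finset (Finset (Fin (2 * m)))) ≤ vex (2 * m) G :=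
    card_le_vex hG fun A hA B hB _ _ => by
      simp only [mem_filter, mem_univ, true_and] at hA hB; omega
  set F : Finset (Finset (Fin (2 * m))) := {A | m ≤ #A} with hF
  have h1 := two_mul_card_eq F
  have h2 : F ∪ Fᶜˢ = univ := by
    ext A
    have := card_le_univ A
    simp only [hF, mem_union, mem_compls, mem_filter, mem_univ, true_and, card_compl,
      Fintype.card_fin, iff_true] at this ⊢
    omega
  have h3 : F ∩ Fᶜˢ = powersetCard m univ := by
    ext A
    have := card_le_univ A
    simp only [hF, mem_inter, mem_compls, mem_filter, mem_univ, true_and, card_compl,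
      Fintype.card_fin, mem_powersetCard, subset_univ] at this ⊢
    omega
  rw [h2, h3, card_powersetCard, card_univ, card_univ, Fintype.card_finset, Fintype.card_fin] at h1
  omega

lemma le_vex_of_odd {G : SimpleGraph V} (hG : ¬ IsMatchingGraph G) (m : ℕ) :
    2 ^ (2 * m) + (2 * m + 1).choose m ≤ vex (2 * m + 1) G + (2 * m).choose m := by
  set P : Finset (Finset (Fin (2 * m + 1))) := {A | m + 1 ≤ #A} with hP
  -- The `m`-sets through `0` meet pairwise, so a disjoint pair in `P ∪ Q` uses at most one of them.
  set Q : Finset (Finset (Fin (2 * m + 1))) := {A ∈ powersetCard m univ | 0 ∈ A} with hQ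
  have hPQ : #(P ∪ Q) ≤ vex (2 * m + 1) G := by
    refine card_le_vex hG fun A hA B hB _ hd => ?_
    simp only [hP, hQ, mem_union, mem_filter, mem_univ, true_and, mem_powersetCard,
      subset_univ] at hA hB
    by_cases h0 : 0 ∈ A ∧ 0 ∈ B
    · exact absurd h0.2 (Finset.disjoint_left.1 hd h0.1)
    · by_cases hA0 : 0 ∈ A
      · have hB0 : 0 ∉ B := fun h => h0 ⟨hA0, h⟩
        simp only [hB0, and_false, or_false] at hB
        omega
      · simp only [hA0, and_false, or_false] at hA
        omega
  have hdisj : Disjoint P Q := by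
    rw [Finset.disjoint_left]
    intro A hA hB
    simp only [hP, hQ, mem_filter, mem_univ, true_and, mem_powersetCard, subset_univ] at hA hB
    omega
  rw [card_union_of_disjoint hdisj] at hPQ
  have h1 := two_mul_card_eq P
  have h2 : P ∪ Pᶜˢ = univ := by
    ext A
    have := card_le_univ A
    simp only [hP, mem_union, mem_compls, mem_filter, mem_univ, true_and, card_compl,
      Fintype.card_fin, iff_true] at this ⊢
    omega
  have h3 : P ∩ Pᶜˢ = ∅ := by
    ext A
    have := card_le_univ A
    simp only [hP, mem_inter, mem_compls, mem_filter, mem_univ, true_and, card_compl,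
      Fintype.card_fin, notMem_empty, iff_false] at this ⊢
    omega
  rw [h2, h3, card_univ, Fintype.card_finset, Fintype.card_fin, card_empty, pow_succ] at h1
  have h4 : #Q + (2 * m).choose m = (2 * m + 1).choose m := by
    have h5 : ({A ∈ powersetCard m univ | 0 ∉ A} : Finset (Finset (Fin (2 * m + 1)))) =
        powersetCard m (univ.erase 0) := by
      ext A
      simp only [mem_filter, mem_powersetCard, subset_univ, true_and, subset_erase]
      tauto
    have h6 : #({A ∈ powersetCard m univ | 0 ∉ A} : Finset (Finset (Fin (2 * m + 1)))) =
        (2 * m).choose m := by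
      rw [h5, card_powersetCard, card_erase_of_mem (mem_univ _), card_univ, Fintype.card_fin,
        Nat.add_sub_cancel]
    rw [← h6, hQ, card_filter_add_card_filter_not, card_powersetCard, card_univ,
      Fintype.card_fin]
  omega

lemma le_vex {G : SimpleGraph V} (hG : ¬ IsMatchingGraph G) (hn : 1 ≤ n) :
    (2 : ℝ) ^ (n - 1) + (1 / 2 - 1 / n) * (n.choose (n / 2) : ℝ) ≤ vex n G := by
  have hn0 : (0 : ℝ) < n := by exact_mod_cast hn
  obtain ⟨m, rfl | rfl⟩ := Nat.even_or_odd' n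
  · have h : (2 : ℝ) ^ (2 * m) + (2 * m).choose m ≤ 2 * vex (2 * m) G := by
      exact_mod_cast le_vex_of_even hG m
    have h1 : (2 : ℝ) ^ (2 * m) = 2 * 2 ^ (2 * m - 1) := by
      rw [← pow_succ']; congr 1; omega
    have h2 : (0 : ℝ) ≤ 1 / ((2 * m : ℕ) : ℝ) * (2 * m).choose m := by positivity
    rw [Nat.mul_div_cancel_left m two_pos]
    linarith
  · have h : (2 : ℝ) ^ (2 * m) + (2 * m + 1).choose m ≤
        vex (2 * m + 1) G + (2 * m).choose m := by
      exact_mod_cast le_vex_of_odd hG m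
    -- The ratio of the two binomials is `(m + 1) / (2 * m + 1) = 1 / 2 + 1 / (2 * n)`, within the
    -- allowed `1 / n`.
    have h1 : ((2 * m + 1 : ℕ) : ℝ) * (2 * m).choose m = (2 * m + 1).choose m * (m + 1) := by
      have := Nat.add_one_mul_choose_eq (2 * m) m
      rw [Nat.choose_symm_half] at this
      exact_mod_cast this
    have h2 : ((2 * m).choose m : ℝ) ≤ (1 / 2 + 1 / ((2 * m + 1 : ℕ) : ℝ)) *
        (2 * m + 1).choose m := by
      refine le_of_mul_le_mul_left ?_ hn0
      rw [h1, ← mul_assoc, mul_add _ (1 / 2 : ℝ), mul_one_div_cancel hn0.ne']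
      push_cast
      nlinarith [Nat.cast_nonneg (α := ℝ) ((2 * m + 1).choose m)]
    rw [show (2 * m + 1) / 2 = m by omega, Nat.add_sub_cancel]
    linarith

end LowerBound

end KneserCube

theorem theorem1 {V : Type*} [Finite V] (G : SimpleGraph V)
    (hbip : G.IsBipartite) (hmatch : ¬ KneserCube.IsMatchingGraph G) :
    ∃ α β : ℕ → ℝ, Tendsto α atTop (𝓝 0) ∧ Tendsto β atTop (𝓝 0) ∧
      ∀ n : ℕ, 1 ≤ n →
        (2 : ℝ) ^ (n - 1) + (1 / 2 - α n) * (n.choose (n / 2) : ℝ)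
            ≤ (KneserCube.vex n G : ℝ) ∧
        (KneserCube.vex n G : ℝ)
            ≤ (2 : ℝ) ^ (n - 1) + (1 + β n) * (n.choose (n / 2) : ℝ) := by
  have hC : ∀ n : ℕ, (0 : ℝ) < n.choose (n / 2) := fun n => by
    exact_mod_cast Nat.choose_pos (Nat.div_le_self n 2)
  refine ⟨fun n => 1 / n,
    -- The normalised excess is only bounded above asymptotically; truncating at `0` makes it
    -- converge.
    fun n => max 0 (((KneserCube.vex n G : ℝ) - 2 ^ (n - 1)) / n.choose (n / 2) - 1),
    tendsto_one_div_atTop_nhds_zero_nat, ?_, fun n hn => ⟨KneserCube.le_vex hmatch hn, ?_⟩⟩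
  · refine tendsto_order.2 ⟨fun a ha => .of_forall fun n => ha.trans_le (le_max_left _ _),
      fun a ha => ?_⟩
    filter_upwards [KneserCube.eventually_vex_le hbip (half_pos ha)] with n h
    refine max_lt ha ?_
    rw [sub_lt_iff_lt_add, div_lt_iff₀ (hC n)]
    nlinarith [hC n, mul_pos ha (hC n)]
  · have h := le_max_right (0 : ℝ)
      (((KneserCube.vex n G : ℝ) - 2 ^ (n - 1)) / n.choose (n / 2) - 1)
    rw [sub_le_iff_le_add, div_le_iff₀ (hC n)] at h
    linarith
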